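/- Let $S$ be a semitopological semigroup (a semigroup with a Hausdorff topology in which $s\mapsto ts$ and $s\mapsto st$ are continuous for each $t\in S$), let $C$ be a nonempty subset of a complex Hilbert space $H$, and let $\mathcal S=\{T_s:s\in S\}$ be a representation of $S$ on $C$, i.e. maps $T_s:C\to C$ with $T_{st}=T_sT_t$. Suppose that $S$ is generated, as a semigroup, by a subset $\Lambda$, and that for each $s\in\Lambda$ the map $T=T_s$ is generalized hybrid: there are $\alpha,\beta\in\mathbb R$ with $$\alpha\|Tx-Ty\|^2+(1-\alpha)\|x-Ty\|^2\le\beta\|Tx-y\|^2+(1-\beta)\|x-y\|^2\qquad(x,y\in C).$$ Suppose that the orbit $\{T_sc:s\in S\}$ is bounded for some $c\in C$. Consider the conditions 1. $C_b(S)$ has a left invariant mean and $s\mapsto T_sc$ is continuous from $S$ into $(C,\mathrm{wk})$; 2. $LUC(S)$ has a left invariant mean and the action $S\times C\to C$ is weakly jointly continuous; 3. $AP(S)$ has a left invariant mean and the action is weakly separately continuous and weakly equicontinuous; 4. $WAP(S)$ has a left invariant mean, the action is weakly separately continuous, and either the action of $S$ on $K$, the closure of $\{T_sc:s\in S\}$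 in $(C,\mathrm{wk})$, is weakly quasi-equicontinuous, or the action of $S$ on $C$ is weakly quasi-equicontinuous and every orbit $\{T_sx:s\in S\}$, $x\in C$, is bounded. Then: (a) If $C$ is closed and convex and any of (1)-(4) holds, then $S$ has a common fixed point: there is $x\in C$ with $T_sx=x$ for all $s\in S$. (b) Without convexity, $\mathcal S$ has an attractive point, i.e. there is $a\in H$ with $\|a-T_sx\|\le\|a-x\|$ for all $s\in S$, $x\in C$, if (1) holds, or if $C$ is weakly closed and any of (2)-(4) holds. Here wk is the weak topology of $H$; $(\ell_sf)(t)=f(st)$; $C_b(S)$ is the space of bounded continuous complex functions on $S$ with the supremum norm; $LUC(S)$ consists of the $f\in C_b(S)$ for which $s\mapsto\ell_sf$ is norm continuous, and $AP(S)$ (resp. $WAP(S)$) of those for which $\{\ell_sf:s\in S\}$ is relatively compact in the norm (resp. weak) topology of $C_b(S)$. A left invariant mean on such a space $X$ is a bounded linear functional $m$ on $X$ with $\|m\|=m(1)=1$ and $m(\ell_sf)=m(f)$ for all $s\in S$, $f\in X$. An action on a space $Y$ is quasi-equicontinuous if the closure of $\{T_s:s\in S\}$ in the product space $Y^Y$ consists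 of continuous maps. -/

import Mathlib

open Set Bornology
open scoped BoundedContinuousFunction

noncomputable section

namespace SemigroupAction

section FunctionSpaces

variable {S : Type*} [Semigroup S] [TopologicalSpace S] [SeparatelyContinuousMul S]

/-- Left translation `(ℓ_s f)(t) = f (s t)` on the space `C_b(S)` of bounded continuous
complex-valued functions (with the supremum norm). -/
def leftTranslate (s : S) (f : S →ᵇ ℂ) : S →ᵇ ℂ :=
  f.compContinuous ⟨fun t => s * t, continuous_const_mul s⟩

@[simp] theorem leftTranslate_apply (s : S) (f : S →ᵇ ℂ) (t : S) :
    leftTranslate s f t = f (s * t) := rfl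

theorem leftTranslate_leftTranslate (s t : S) (f : S →ᵇ ℂ) :
    leftTranslate s (leftTranslate t f) = leftTranslate (t * s) f := by
  ext u; simp [mul_assoc]

/-- A linear subspace of `C_b(S)` containing the constant functions and invariant under left
translations. -/
structure InvariantSubspace (S : Type*) [Semigroup S] [TopologicalSpace S]
    [SeparatelyContinuousMul S] extends Submodule ℂ (S →ᵇ ℂ) where
  one_mem' : (1 : S →ᵇ ℂ) ∈ carrier
  leftTranslate_mem' : ∀ (s : S) {f : S →ᵇ ℂ}, f ∈ carrier → leftTranslate s f ∈ carrier

/-- `X` has a left invariant mean: a bounded linear functional `m` on `X` with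
`‖m‖ = m(1) = 1` and `m(ℓ_s f) = m(f)` for all `s ∈ S`, `f ∈ X`. -/
def HasLeftInvariantMean (X : InvariantSubspace S) : Prop :=
  ∃ m : X.toSubmodule →L[ℂ] ℂ,
    ‖m‖ = 1 ∧ m ⟨1, X.one_mem'⟩ = 1 ∧
      ∀ (s : S) (f : S →ᵇ ℂ) (hf : f ∈ X.toSubmodule),
        m ⟨leftTranslate s f, X.leftTranslate_mem' s hf⟩ = m ⟨f, hf⟩

variable (S)

/-- The whole space `C_b(S)`. -/
def Cb : InvariantSubspace S where
  toSubmodule := ⊤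
  one_mem' := trivial
  leftTranslate_mem' _ _ _ := trivial

/-- `LUC(S)`: those `f ∈ C_b(S)` for which `s ↦ ℓ_s f` is norm continuous. -/
def LUC : InvariantSubspace S where
  carrier := {f | Continuous fun s : S => leftTranslate s f}
  add_mem' {_ _} hf hg := hf.add hg
  zero_mem' := continuous_const (y := (0 : S →ᵇ ℂ))
  smul_mem' a _ hf := hf.const_smul a
  one_mem' := continuous_const (y := (1 : S →ᵇ ℂ))
  leftTranslate_mem' t f hf := by
    have h : Continuous fun s : S => leftTranslate (t * s) f :=
      Continuous.comp (g := fun s : S => leftTranslate s f) hf (continuous_const_mul t)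
    simpa only [mem_ofPred_eq, leftTranslate_leftTranslate] using h

/-- `AP(S)`: those `f ∈ C_b(S)` whose left orbit `{ℓ_s f : s ∈ S}` is relatively compact in the
norm topology of `C_b(S)`. -/
def AP : InvariantSubspace S where
  carrier := {f | ∃ K : Set (S →ᵇ ℂ), IsCompact K ∧ ∀ s : S, leftTranslate s f ∈ K}
  add_mem' := by
    rintro f g ⟨K, hK, hf⟩ ⟨L, hL, hg⟩
    exact ⟨_, (hK.prod hL).image continuous_add, fun s => ⟨(_, _), ⟨hf s, hg s⟩, rfl⟩⟩
  zero_mem' := ⟨{0}, isCompact_singleton, fun _ => rfl⟩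
  smul_mem' := by
    rintro a f ⟨K, hK, hf⟩
    exact ⟨_, hK.image (continuous_const_smul a), fun s => ⟨_, hf s, rfl⟩⟩
  one_mem' := ⟨{1}, isCompact_singleton, fun _ => rfl⟩
  leftTranslate_mem' := by
    rintro t f ⟨K, hK, hf⟩
    exact ⟨K, hK, fun s => by rw [leftTranslate_leftTranslate]; exact hf _⟩

/-- `WAP(S)`: those `f ∈ C_b(S)` whose left orbit `{ℓ_s f : s ∈ S}` is relatively compact in the
weak topology of the Banach space `C_b(S)`. -/
def WAP : InvariantSubspace S where
  carrier := {f | ∃ K : Set (WeakSpace ℂ (S →ᵇ ℂ)), IsCompact K ∧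
    ∀ s : S, toWeakSpace ℂ (S →ᵇ ℂ) (leftTranslate s f) ∈ K}
  add_mem' := by
    rintro f g ⟨K, hK, hf⟩ ⟨L, hL, hg⟩
    exact ⟨_, (hK.prod hL).image continuous_add, fun s => ⟨(_, _), ⟨hf s, hg s⟩, rfl⟩⟩
  zero_mem' := ⟨{toWeakSpace ℂ (S →ᵇ ℂ) 0}, isCompact_singleton, fun _ => rfl⟩
  smul_mem' := by
    rintro a f ⟨K, hK, hf⟩
    exact ⟨_, hK.image (continuous_const_smul a), fun s => ⟨_, hf s, rfl⟩⟩
  one_mem' := ⟨{toWeakSpace ℂ (S →ᵇ ℂ) 1}, isCompact_singleton, fun _ => rfl⟩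
  leftTranslate_mem' := by
    rintro t f ⟨K, hK, hf⟩
    exact ⟨K, hK, fun s => by rw [leftTranslate_leftTranslate]; exact hf _⟩

end FunctionSpaces

section Actions

variable {S : Type*} {H : Type*} [NormedAddCommGroup H] [InnerProductSpace ℂ H] {C : Set H}

/-- The set `C` carrying the topology induced by the weak topology of `H`. -/
def Wk (C : Set H) : Type _ := C

instance (C : Set H) : TopologicalSpace (Wk C) :=
  TopologicalSpace.induced (fun x : C => toWeakSpace ℂ H (x : H)) inferInstance

/-- The maps `T_s`, regarded as self maps of `C` with its weak topology. -/
def wkMap {C : Set H} (T : S → C → C) : S → Wk C → Wk C := T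

/-- `C` is closed in the weak topology of `H`. -/
def IsWeaklyClosed (C : Set H) : Prop := IsClosed (toWeakSpace ℂ H '' C)

/-- `T` is a representation of the semigroup `S` as self mappings of `C`. -/
def IsRepresentation [Semigroup S] (T : S → C → C) : Prop :=
  ∀ (s t : S) (x : C), T (s * t) x = T s (T t x)

/-- `U : C → C` is a generalized hybrid mapping. -/
def IsGeneralizedHybrid (U : C → C) : Prop :=
  ∃ α β : ℝ, ∀ x y : C,
    α * ‖(U x : H) - U y‖ ^ 2 + (1 - α) * ‖(x : H) - U y‖ ^ 2
      ≤ β * ‖(U x : H) - y‖ ^ 2 + (1 - β) * ‖(x : H) - y‖ ^ 2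

/-- The orbit `{T_s x : s ∈ S}` is norm bounded. -/
def HasBoundedOrbit (T : S → C → C) (x : C) : Prop :=
  IsBounded (range fun s : S => (T s x : H))

/-- The set of common fixed points. -/
def commonFixedPoints (T : S → C → C) : Set C := {x | ∀ s, T s x = x}

/-- The set of (common) attractive points; they need not belong to `C`. -/
def attractivePoints (T : S → C → C) : Set H :=
  {a | ∀ (s : S) (x : C), ‖a - T s x‖ ≤ ‖a - x‖}

/-- `s ↦ T_s x` is continuous from `S` into `C` with the weak topology. -/
def IsWeaklyContinuousOrbit [TopologicalSpace S] (T : S → C → C) (x : Wk C) : Prop :=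
  Continuous fun s : S => wkMap T s x

/-- `(s, x) ↦ T_s x` is separately continuous for the weak topology of `C`. -/
def IsWeaklySeparatelyContinuous [TopologicalSpace S] (T : S → C → C) : Prop :=
  (∀ x : C, IsWeaklyContinuousOrbit T x) ∧ ∀ s : S, Continuous (wkMap T s)

/-- `(s, x) ↦ T_s x` is jointly continuous for the weak topology of `C`. -/
def IsWeaklyJointlyContinuous [TopologicalSpace S] (T : S → C → C) : Prop :=
  Continuous fun p : S × Wk C => wkMap T p.1 p.2

/-- The family `{T_s : s ∈ S}` is equicontinuous at every point of `C` for the weak topology: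
the uniformity of the weak topology is the one generated by the bounded linear functionals, so
this is tested functional by functional. -/
def IsWeaklyEquicontinuous (T : S → C → C) : Prop :=
  ∀ f : H →L[ℂ] ℂ, Equicontinuous fun (s : S) (x : Wk C) => f (T s x : H)

/-- The action is weakly quasi-equicontinuous on `K ⊆ C`: every pointwise weak limit on `K`
of a net of maps `T_{s_i}` is weakly continuous on `K`. -/
def IsWeaklyQuasiEquicontinuousOn (T : S → C → C) (K : Set (Wk C)) : Prop :=
  ∀ g ∈ closure (range fun (s : S) (x : K) => wkMap T s x.1), Continuous g

/-- The action is weakly quasi-equicontinuous on `C`: the closure of `{T_s : s ∈ S}` in the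
product space `C ^ C`, `C` with its weak topology, consists of continuous maps. -/
def IsWeaklyQuasiEquicontinuous (T : S → C → C) : Prop :=
  ∀ g ∈ closure (range (wkMap T)), Continuous g

/-- The weak closure, relative to `C`, of the orbit of `x`. -/
def weakOrbitClosure (T : S → C → C) (x : Wk C) : Set (Wk C) :=
  closure (range fun s : S => wkMap T s x)

variable [Semigroup S] [TopologicalSpace S] [SeparatelyContinuousMul S]

/-- `C_b(S)` has a left invariant mean and the orbit map of `c` is weakly continuous. -/
def CbCondition (T : S → C → C) (c : C) : Prop :=
  HasLeftInvariantMean (Cb S) ∧ IsWeaklyContinuousOrbit T c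

/-- `S` is left amenable, i.e. `LUC(S)` has a left invariant mean, and the action is weakly
jointly continuous. -/
def LUCCondition (T : S → C → C) : Prop :=
  HasLeftInvariantMean (LUC S) ∧ IsWeaklyJointlyContinuous T

/-- `AP(S)` has a left invariant mean and the action is weakly separately continuous and weakly
equicontinuous. -/
def APCondition (T : S → C → C) : Prop :=
  HasLeftInvariantMean (AP S) ∧ IsWeaklySeparatelyContinuous T ∧ IsWeaklyEquicontinuous T

/-- `WAP(S)` has a left invariant mean, and the action is weakly separately continuous and weakly
quasi-equicontinuous: either as an action on the weak closure of the orbit of `c`, or as an action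
on the whole of `C`, provided all its orbits are bounded. -/
def WAPCondition (T : S → C → C) (c : C) : Prop :=
  HasLeftInvariantMean (WAP S) ∧ IsWeaklySeparatelyContinuous T ∧
    (IsWeaklyQuasiEquicontinuousOn T (weakOrbitClosure T c) ∨
      (IsWeaklyQuasiEquicontinuous T ∧ ∀ x : C, HasBoundedOrbit T x))

end Actions

end SemigroupAction

end

/-! Extend the invariant mean to a functional `m` on `C_b(S)` by Hahn–Banach, and let `a` be the
barycentre of the bounded orbit: `m` of `s ↦ ⟪y, T_s c⟫` equals `⟪y, a⟫` for all `y`. For `t ∈ Λ`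
apply the hybrid inequality to `z` and the points `T_s c, T_t T_s c, T_t² T_s c, …`. Summed over `n`
steps, the squared norms of orbit points telescope to a bounded term, so the mean is only ever
applied to weak coordinates. By invariance the linear terms have mean `n (⟪T_t z, a⟫ - ⟪z, a⟫)`;
letting `n` grow gives `‖a - T_t z‖ ≤ ‖a - z‖`. This is `attractivePoints_nonempty_of_mean`. In a
closed convex `C`, the point nearest to `a` is then fixed.

It remains to place the weak coordinates of the orbit in the space carrying the mean. For `C_b(S)`
this is immediate. Otherwise the weak orbit closure `K` is compact, the coordinates and their
translates come from `C(K)`, and the hypothesis on the action gives norm continuity, norm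
compactness (Arzelà–Ascoli) or weak compactness (Grothendieck, `continuous_apply_of_pointwise`)
there. -/

noncomputable section

open Filter Topology MeasureTheory
open scoped NNReal CompactlySupported

/-! ### Weak and pointwise convergence in `C(K)`: Grothendieck's theorem. -/

section Grothendieck

variable {K : Type*} [TopologicalSpace K]

/-- The values of a functional on the functions dominated by `g`. -/
def dominatedValues (φ : C(K, ℂ) →L[ℂ] ℂ) (g : K → ℝ≥0) : Set ℝ≥0 :=
  {r | ∃ h : C(K, ℂ), (∀ x, ‖h x‖₊ ≤ g x) ∧ r = ‖φ h‖₊}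

theorem dominatedValues_nonempty (φ : C(K, ℂ) →L[ℂ] ℂ) (g : K → ℝ≥0) :
    (dominatedValues φ g).Nonempty :=
  ⟨_, 0, by simp, rfl⟩

variable [CompactSpace K]

theorem bddAbove_dominatedValues (φ : C(K, ℂ) →L[ℂ] ℂ) {g : K → ℝ≥0} (hg : Continuous g) :
    BddAbove (dominatedValues φ g) := by
  obtain ⟨M, hM⟩ := (isCompact_range hg).bddAbove
  refine ⟨‖φ‖₊ * M, ?_⟩
  rintro _ ⟨h, hh, rfl⟩
  refine (φ.le_opNNNorm h).trans (mul_le_mul_right ?_ _)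
  rw [← NNReal.coe_le_coe, coe_nnnorm, ContinuousMap.norm_le _ M.coe_nonneg]
  exact fun x => NNReal.coe_le_coe.2 ((hh x).trans (hM ⟨x, rfl⟩))

theorem nnnorm_apply_le_sSup (φ : C(K, ℂ) →L[ℂ] ℂ) {g : K → ℝ≥0} (hg : Continuous g)
    {h : C(K, ℂ)} (hh : ∀ x, ‖h x‖₊ ≤ g x) : ‖φ h‖₊ ≤ sSup (dominatedValues φ g) :=
  le_csSup (bddAbove_dominatedValues φ hg) ⟨h, hh, rfl⟩

theorem sSup_dominatedValues_smul_le (φ : C(K, ℂ) →L[ℂ] ℂ) {g : K → ℝ≥0} (hg : Continuous g)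
    {r : ℝ≥0} (hr : r ≠ 0) :
    sSup (dominatedValues φ (r • g)) ≤ r * sSup (dominatedValues φ g) := by
  refine csSup_le (dominatedValues_nonempty _ _) ?_
  rintro _ ⟨h, hh, rfl⟩
  have h1 : ‖φ ((((r⁻¹ : ℝ≥0) : ℝ) : ℂ) • h)‖₊ ≤ sSup (dominatedValues φ g) := by
    refine nnnorm_apply_le_sSup φ hg fun x => ?_
    have := hh x
    simp only [ContinuousMap.smul_apply, nnnorm_smul, Complex.nnnorm_real, NNReal.nnnorm_eq]
    rw [inv_mul_le_iff₀ (pos_iff_ne_zero.2 hr)]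
    simpa using this
  rw [map_smul, nnnorm_smul, Complex.nnnorm_real, NNReal.nnnorm_eq,
    inv_mul_le_iff₀ (pos_iff_ne_zero.2 hr)] at h1
  exact h1

theorem sSup_dominatedValues_smul (φ : C(K, ℂ) →L[ℂ] ℂ) {g : K → ℝ≥0} (hg : Continuous g)
    (r : ℝ≥0) : sSup (dominatedValues φ (r • g)) = r * sSup (dominatedValues φ g) := by
  rcases eq_or_ne r 0 with rfl | hr
  · rw [zero_mul]
    refine le_antisymm (csSup_le (dominatedValues_nonempty _ _) ?_) zero_le
    rintro _ ⟨h, hh, rfl⟩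
    have : h = 0 := by ext x; simpa using hh x
    simp [this]
  · refine (sSup_dominatedValues_smul_le φ hg hr).antisymm ?_
    have := sSup_dominatedValues_smul_le φ (g := r • g) (by fun_prop) (inv_ne_zero hr)
    rw [inv_smul_smul₀ hr] at this
    rwa [le_inv_mul_iff₀ (pos_iff_ne_zero.2 hr)] at this

theorem exists_norm_one_mul_eq_norm (z : ℂ) : ∃ w : ℂ, ‖w‖ = 1 ∧ w * z = ‖z‖ := by
  rcases eq_or_ne z 0 with rfl | hz
  · exact ⟨1, by simp⟩
  · have hz' : (‖z‖ : ℂ) ≠ 0 := by simpa using hz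
    refine ⟨‖z‖ / z, by simp [hz], by field_simp⟩

/-- Additivity makes the supremum a positive functional, the total variation of `φ`. For `≤`, split
`h` into its multiples by `gᵢ / (g₁ + g₂ + δ)`; `δ` avoids division by zero and costs at most `‖φ‖
δ`. For `≥`, rotate `h₁` and `h₂` by unit scalars so that the moduli of their values add. -/
theorem sSup_dominatedValues_add (φ : C(K, ℂ) →L[ℂ] ℂ) {g₁ g₂ : K → ℝ≥0} (hg₁ : Continuous g₁)
    (hg₂ : Continuous g₂) : sSup (dominatedValues φ (g₁ + g₂)) =
      sSup (dominatedValues φ g₁) + sSup (dominatedValues φ g₂) := by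
  refine le_antisymm (csSup_le (dominatedValues_nonempty _ _) ?_) ?_
  · rintro _ ⟨h, hh, rfl⟩
    have key : ∀ δ : ℝ≥0, 0 < δ → ‖φ h‖₊ ≤ sSup (dominatedValues φ g₁) +
        sSup (dominatedValues φ g₂) + ‖φ‖₊ * δ := by
      intro δ hδ
      have hpos : ∀ x, 0 < g₁ x + g₂ x + δ := fun x => by positivity
      have hu : ∀ u : K → ℝ≥0, Continuous u →
          Continuous fun x => ((u x / (g₁ x + g₂ x + δ) : ℝ≥0) : ℝ) := fun u hu =>
        NNReal.continuous_coe.comp (hu.div (by fun_prop) fun x => (hpos x).ne')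
      let p : (u : K → ℝ≥0) → Continuous u → C(K, ℂ) := fun u huc =>
        ⟨fun x => (((u x / (g₁ x + g₂ x + δ) : ℝ≥0) : ℝ) : ℂ) * h x,
          (Complex.continuous_ofReal.comp (hu u huc)).mul h.continuous⟩
      have hp : ∀ u huc x, ‖p u huc x‖₊ ≤ u x := by
        intro u huc x
        simp only [p, ContinuousMap.coe_mk, nnnorm_mul, Complex.nnnorm_real, NNReal.nnnorm_eq]
        rw [div_mul_eq_mul_div, div_le_iff₀ (hpos x)]
        refine mul_le_mul_right ((hh x).trans ?_) _
        exact le_self_add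
      have hsum : h = p g₁ hg₁ + p g₂ hg₂ + p (fun _ => δ) continuous_const := by
        ext x
        have : ((g₁ x : ℂ) + g₂ x + δ) ≠ 0 := by
          have := (hpos x).ne'
          exact_mod_cast this
        simp [p]
        field_simp
      conv_lhs => rw [hsum, map_add, map_add]
      refine (nnnorm_add_le _ _).trans (add_le_add ((nnnorm_add_le _ _).trans (add_le_add
        (nnnorm_apply_le_sSup φ hg₁ (hp _ hg₁)) (nnnorm_apply_le_sSup φ hg₂ (hp _ hg₂)))) ?_)
      refine (φ.le_opNNNorm _).trans (mul_le_mul_right ?_ _)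
      rw [← NNReal.coe_le_coe, coe_nnnorm, ContinuousMap.norm_le _ δ.coe_nonneg]
      exact fun x => NNReal.coe_le_coe.2 (hp _ continuous_const x)
    have hlim : Tendsto (fun δ : ℝ≥0 => sSup (dominatedValues φ g₁) +
        sSup (dominatedValues φ g₂) + ‖φ‖₊ * δ) (𝓝[>] 0) (𝓝 (sSup (dominatedValues φ g₁) +
        sSup (dominatedValues φ g₂) + ‖φ‖₊ * 0)) :=
      (Continuous.tendsto (by fun_prop) 0).mono_left nhdsWithin_le_nhds
    rw [mul_zero, add_zero] at hlim
    exact ge_of_tendsto hlim (eventually_mem_nhdsWithin.mono fun δ hδ => key δ hδ)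
  · have h1 : ∀ r₁ ∈ dominatedValues φ g₁, ∀ r₂ ∈ dominatedValues φ g₂,
        r₁ + r₂ ≤ sSup (dominatedValues φ (g₁ + g₂)) := by
      rintro _ ⟨h₁, hh₁, rfl⟩ _ ⟨h₂, hh₂, rfl⟩
      obtain ⟨w₁, hw₁, e₁⟩ := exists_norm_one_mul_eq_norm (φ h₁)
      obtain ⟨w₂, hw₂, e₂⟩ := exists_norm_one_mul_eq_norm (φ h₂)
      have hw₁' : ‖w₁‖₊ = 1 := NNReal.eq hw₁
      have hw₂' : ‖w₂‖₊ = 1 := NNReal.eq hw₂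
      have : ‖φ (w₁ • h₁ + w₂ • h₂)‖₊ = ‖φ h₁‖₊ + ‖φ h₂‖₊ := by
        rw [map_add, map_smul, map_smul, smul_eq_mul, smul_eq_mul, e₁, e₂, ← Complex.ofReal_add,
          Complex.nnnorm_real]
        ext
        simp [abs_of_nonneg, add_nonneg]
      rw [← this]
      refine nnnorm_apply_le_sSup φ (g := g₁ + g₂) (by fun_prop) fun x => ?_
      refine (nnnorm_add_le _ _).trans (add_le_add ?_ ?_)
      · simpa [nnnorm_smul, hw₁'] using hh₁ x
      · simpa [nnnorm_smul, hw₂'] using hh₂ x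
    have h2 : sSup (dominatedValues φ g₁) ≤
        sSup (dominatedValues φ (g₁ + g₂)) - sSup (dominatedValues φ g₂) := by
      refine csSup_le (dominatedValues_nonempty _ _) fun r₁ hr₁ => ?_
      refine le_tsub_of_add_le_left ?_
      rw [← le_tsub_iff_right]
      · exact csSup_le (dominatedValues_nonempty _ _) fun r₂ hr₂ =>
          le_tsub_of_add_le_left (h1 r₁ hr₁ r₂ hr₂)
      · exact le_self_add.trans (h1 r₁ hr₁ _ (dominatedValues_nonempty _ _).some_mem)
    refine (add_le_add_left h2 _).trans (tsub_add_cancel_of_le ?_).le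
    exact csSup_le (dominatedValues_nonempty _ _) fun r₂ hr₂ =>
      le_add_self.trans (h1 _ (dominatedValues_nonempty _ _).some_mem r₂ hr₂)

/-- Every bounded functional on `C(K)` is dominated by a finite measure. -/
theorem exists_measure_norm_apply_le [T2Space K] [MeasurableSpace K] [BorelSpace K]
    (φ : C(K, ℂ) →L[ℂ] ℂ) :
    ∃ μ : Measure K, IsFiniteMeasure μ ∧ ∀ h : C(K, ℂ), ‖φ h‖ ≤ ∫ x, ‖h x‖ ∂μ := by
  -- The measure represents the total variation of `φ`, through Riesz–Markov–Kakutani.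
  let Φ : C_c(K, ℝ≥0) →ₗ[ℝ≥0] ℝ≥0 :=
    { toFun := fun g => sSup (dominatedValues φ g)
      map_add' := fun g₁ g₂ => sSup_dominatedValues_add φ g₁.continuous g₂.continuous
      map_smul' := fun r g => sSup_dominatedValues_smul φ g.continuous r }
  refine ⟨NNRealRMK.rieszMeasure Φ, inferInstance, fun h => ?_⟩
  let g : C_c(K, ℝ≥0) :=
    ⟨⟨fun x => ‖h x‖₊, by fun_prop⟩, HasCompactSupport.of_compactSpace _⟩
  have h1 := NNRealRMK.integral_rieszMeasure Φ g
  have h2 : ‖φ h‖₊ ≤ Φ g := nnnorm_apply_le_sSup φ g.continuous fun x => le_rfl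
  calc ‖φ h‖ ≤ Φ g := h2
    _ = _ := h1.symm

/-- A bounded, pointwise convergent sequence in `C(K)` converges weakly. -/
theorem tendsto_apply_of_tendsto_pointwise [T2Space K] (φ : C(K, ℂ) →L[ℂ] ℂ) {h : ℕ → C(K, ℂ)}
    {h₀ : C(K, ℂ)} {M : ℝ} (hM : ∀ n, ‖h n‖ ≤ M)
    (hlim : ∀ x, Tendsto (fun n => h n x) atTop (𝓝 (h₀ x))) :
    Tendsto (fun n => φ (h n)) atTop (𝓝 (φ h₀)) := by
  borelize K
  obtain ⟨μ, hμ, hφ⟩ := exists_measure_norm_apply_le φ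
  rw [tendsto_iff_norm_sub_tendsto_zero]
  have h1 : Tendsto (fun n => ∫ x, ‖(h n - h₀) x‖ ∂μ) atTop (𝓝 (∫ _, (0 : ℝ) ∂μ)) := by
    refine tendsto_integral_of_dominated_convergence (fun _ => M + ‖h₀‖)
      (fun n => (h n - h₀).continuous.norm.aestronglyMeasurable) (integrable_const _) ?_ ?_
    · refine fun n => Eventually.of_forall fun x => ?_
      rw [norm_norm]
      exact ((h n - h₀).norm_coe_le_norm x).trans ((norm_sub_le _ _).trans
        (by gcongr; exact hM n))
    · refine Eventually.of_forall fun x => ?_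
      have := ((hlim x).sub_const (h₀ x)).norm
      simpa using this
  rw [integral_zero] at h1
  refine squeeze_zero (fun _ => norm_nonneg _) (fun n => ?_) h1
  rw [← map_sub]
  exact hφ _

theorem exists_finset_approx {Y : Type*} (F : Y → C(K, ℂ)) (A : Finset Y) {ε : ℝ} (hε : 0 < ε) :
    ∃ E : Finset K, ∀ x, ∃ x' ∈ E, ∀ y ∈ A, dist (F y x) (F y x') < ε := by
  have hU : ∀ x' : K, {x | ∀ y ∈ A, dist (F y x) (F y x') < ε} ∈ 𝓝 x' := fun x' => by
    refine (eventually_all_finset A).2 fun y _ => ?_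
    exact (F y).continuous.continuousAt.eventually (Metric.ball_mem_nhds _ hε)
  obtain ⟨E, hE⟩ := CompactSpace.elim_nhds_subcover _ hU
  refine ⟨E, fun x => ?_⟩
  have : x ∈ ⋃ x' ∈ E, {x | ∀ y ∈ A, dist (F y x) (F y x') < ε} := hE ▸ trivial
  simpa using this

variable {Y : Type*} [TopologicalSpace Y]

/-- A pointwise compact set of continuous functions on a compact space is sequentially dense in
the pointwise closure of each of its subsets. -/
theorem exists_seq_tendsto_pointwise [CompactSpace Y] (F : Y → C(K, ℂ))
    (hF : ∀ x, Continuous fun y => F y x) {B : Set Y} {y₀ : Y} (hy₀ : y₀ ∈ closure B) :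
    ∃ σ : ℕ → Y, (∀ n, σ n ∈ B) ∧ ∀ x, Tendsto (fun n => F (σ n) x) atTop (𝓝 (F y₀ x)) := by
  classical
  have hE : ∀ (A : Finset Y) (k : ℕ), ∃ E : Finset K, ∀ x, ∃ x' ∈ E, ∀ y ∈ A,
      dist (F y x) (F y x') < 1 / ((k : ℝ) + 1) := fun A k =>
    exists_finset_approx F A Nat.one_div_pos_of_nat
  choose E hE using hE
  -- Every subset `A'` of `A` is included because the sets built below increase: the choice at stage
  -- `m` must still be good on the test points of all stages `n ≤ m`.
  have hstep : ∀ (n : ℕ) (A : Finset Y), ∃ y ∈ B, ∀ A' ∈ A.powerset, ∀ k ∈ Finset.range (n + 1),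
      ∀ x ∈ E A' k, dist (F y x) (F y₀ x) < 1 / ((n : ℝ) + 1) := by
    intro n A
    have h1 : ∀ᶠ y in 𝓝 y₀, ∀ A' ∈ A.powerset, ∀ k ∈ Finset.range (n + 1),
        ∀ x ∈ E A' k, dist (F y x) (F y₀ x) < 1 / ((n : ℝ) + 1) := by
      refine (eventually_all_finset _).2 fun A' _ => (eventually_all_finset _).2 fun k _ =>
        (eventually_all_finset _).2 fun x _ => ?_
      exact (hF x).continuousAt.eventually (Metric.ball_mem_nhds _ Nat.one_div_pos_of_nat)
    obtain ⟨y, hy, hyB⟩ := ((mem_closure_iff_frequently.1 hy₀).and_eventually h1).exists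
    exact ⟨y, hy, hyB⟩
  choose next hnextB hnext using hstep
  let A : ℕ → Finset Y := fun n => Nat.rec {y₀} (fun n A => insert (next n A) A) n
  have hA : ∀ n, A (n + 1) = insert (next n (A n)) (A n) := fun n => rfl
  have hAmono : Monotone A := monotone_nat_of_le_succ fun n => by
    rw [hA]; exact Finset.subset_insert _ _
  let σ : ℕ → Y := fun n => next n (A n)
  have hσA : ∀ {i n}, i < n → σ i ∈ A n := fun {i n} hin =>
    hAmono (Nat.succ_le_of_lt hin) (by rw [hA]; exact Finset.mem_insert_self _ _)
  have hy₀A : ∀ n, y₀ ∈ A n := fun n => hAmono (Nat.zero_le n) (Finset.mem_singleton_self _)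
  refine ⟨σ, fun n => hnextB _ _, fun x => ?_⟩
  choose z hzE hz using fun n => hE (A n) n x
  -- Along an ultrafilter, `σ` has a limit `y` and `z` a limit `x'`. The proof is the chain `F y x =
  -- F y x' = F y₀ x' = F y₀ x`.
  rw [tendsto_iff_ultrafilter]
  intro U hU
  have hsmall : Tendsto (fun n : ℕ => 1 / ((n : ℝ) + 1)) U (𝓝 0) :=
    tendsto_one_div_add_atTop_nhds_zero_nat.mono_left hU
  obtain ⟨y, -, hy⟩ := isCompact_univ.ultrafilter_le_nhds (U.map σ) (by simp)
  obtain ⟨x', -, hx'⟩ := isCompact_univ.ultrafilter_le_nhds (U.map z) (by simp)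
  have hyU : Tendsto σ U (𝓝 y) := hy
  have hzU : Tendsto z U (𝓝 x') := hx'
  have hFy : ∀ w, Tendsto (fun n => F (σ n) w) U (𝓝 (F y w)) := fun w =>
    ((hF w).tendsto y).comp hyU
  -- From stage `n` on, `σ m` is nearly `y₀` at the test point `z n`.
  have hagree : ∀ n, F y (z n) = F y₀ (z n) := by
    intro n
    refine tendsto_nhds_unique (hFy (z n)) (tendsto_iff_dist_tendsto_zero.2 ?_)
    refine squeeze_zero' (Eventually.of_forall fun _ => dist_nonneg) ?_ hsmall
    filter_upwards [hU (eventually_ge_atTop n)] with m hm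
    exact (hnext m (A m) (A n) (Finset.mem_powerset.2 (hAmono hm)) n
      (Finset.mem_range.2 (Nat.lt_succ_of_le hm)) _ (hzE n)).le
  have hx'y : F y x' = F y₀ x' := by
    refine tendsto_nhds_unique (((F y).continuous.tendsto x').comp hzU) ?_
    rw [show (F y : K → ℂ) ∘ z = F y₀ ∘ z from funext hagree]
    exact ((F y₀).continuous.tendsto x').comp hzU
  -- The points `z n` imitate `x` ever better for each `w` that enters the sets `A n`, that is for
  -- `y₀` and all `σ i`.
  have hsame : ∀ w, (∀ᶠ n in atTop, w ∈ A n) → F w x' = F w x := by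
    intro w hw
    refine tendsto_nhds_unique (((F w).continuous.tendsto x').comp hzU)
      (tendsto_iff_dist_tendsto_zero.2 ?_)
    refine squeeze_zero' (Eventually.of_forall fun _ => dist_nonneg) ?_ hsmall
    filter_upwards [hU hw] with n hn
    rw [dist_comm]
    exact (hz n w hn).le
  have hyx : F y x' = F y x := by
    refine tendsto_nhds_unique (hFy x') ?_
    rw [show (fun n => F (σ n) x') = fun n => F (σ n) x from
      funext fun i => hsame _ ((eventually_gt_atTop i).mono fun n hn => hσA hn)]
    exact hFy x
  rw [← hsame y₀ (Eventually.of_forall hy₀A), ← hx'y, hyx]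
  exact hFy x

/-- **Grothendieck's theorem**: a bounded family in `C(K)`, parametrized by a compact space and
continuous in the parameter for pointwise convergence, is weakly continuous in the parameter. -/
theorem continuous_apply_of_pointwise [T2Space K] [CompactSpace Y] (F : Y → C(K, ℂ))
    (hF : ∀ x, Continuous fun y => F y x) {M : ℝ} (hM : ∀ y, ‖F y‖ ≤ M)
    (φ : C(K, ℂ) →L[ℂ] ℂ) : Continuous fun y => φ (F y) := by
  refine continuous_iff_continuousAt.2 fun y₀ => ?_
  rw [ContinuousAt, Metric.tendsto_nhds]
  intro ε hε
  by_contra hcon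
  have hfreq : ∃ᶠ y in 𝓝 y₀, y ∈ {y | ¬ dist (φ (F y)) (φ (F y₀)) < ε} := not_eventually.1 hcon
  obtain ⟨σ, hσ, hlim⟩ := exists_seq_tendsto_pointwise F hF (mem_closure_iff_frequently.2 hfreq)
  have h1 := tendsto_apply_of_tendsto_pointwise φ (fun n => hM (σ n)) hlim
  obtain ⟨n, hn⟩ := ((Metric.tendsto_nhds.1 h1) ε hε).exists
  exact hσ n hn

end Grothendieck

namespace SemigroupAction

/-! ### Means on `C_b(S)`: positivity, extension and invariance. -/

section Mean

/-- A functional of norm at most one on `C_b(S)` that fixes the constants respects upper bounds of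
real parts. -/
theorem re_apply_le_of_forall_re_le {S : Type*} [TopologicalSpace S] {m : (S →ᵇ ℂ) →L[ℂ] ℂ}
    (hm : ‖m‖ ≤ 1) (hm1 : m 1 = 1) {f : S →ᵇ ℂ} {r : ℝ} (hf : ∀ s, (f s).re ≤ r) :
    (m f).re ≤ r := by
  by_contra! hlt
  set g : S →ᵇ ℂ := f - (r : ℂ) • 1 with hg
  set x : ℝ := (m f).re - r with hx
  have hx0 : 0 < x := sub_pos.2 hlt
  -- Since `Re g ≤ 0`, a shift by `l` gives `(x + l)² ≤ ‖g‖² + l²`, hence `x² + 2 x l ≤ ‖g‖²`. This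
  -- `l` makes `x l = ‖g‖² + x`, which is too large.
  set l : ℝ := ‖g‖ ^ 2 / x + 1 with hl
  have hl0 : 0 < l := by positivity
  have hnorm : ‖g + (l : ℂ) • 1‖ ≤ √(‖g‖ ^ 2 + l ^ 2) := by
    refine (BoundedContinuousFunction.norm_le (Real.sqrt_nonneg _)).2 fun s => ?_
    refine Real.le_sqrt_of_sq_le ?_
    have h1 : ‖g s‖ ^ 2 ≤ ‖g‖ ^ 2 := by gcongr; exact g.norm_coe_le_norm s
    have h2 : (g s).re ≤ 0 := by simpa [hg] using hf s
    have h3 : ‖(g + (l : ℂ) • 1) s‖ ^ 2 = ‖g s‖ ^ 2 + 2 * l * (g s).re + l ^ 2 := by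
      rw [← Complex.normSq_eq_norm_sq, ← Complex.normSq_eq_norm_sq, Complex.normSq_apply,
        Complex.normSq_apply]
      simp
      ring
    rw [h3]
    nlinarith
  have hre : (m (g + (l : ℂ) • 1)).re = x + l := by
    simp [hg, hm1, hx]
  have h1 : x + l ≤ √(‖g‖ ^ 2 + l ^ 2) := by
    rw [← hre]
    calc _ ≤ ‖m (g + (l : ℂ) • 1)‖ := Complex.re_le_norm _
      _ ≤ ‖m‖ * ‖g + (l : ℂ) • 1‖ := m.le_opNorm _
      _ ≤ 1 * ‖g + (l : ℂ) • 1‖ := by gcongr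
      _ ≤ _ := by rwa [one_mul]
  have h2 : (x + l) ^ 2 ≤ ‖g‖ ^ 2 + l ^ 2 := by
    rw [← Real.sq_sqrt (show 0 ≤ ‖g‖ ^ 2 + l ^ 2 by positivity)]
    gcongr
  have h3 : x * l = ‖g‖ ^ 2 + x := by rw [hl]; field_simp
  nlinarith [sq_nonneg ‖g‖]

variable {S : Type*} [Semigroup S] [TopologicalSpace S] [SeparatelyContinuousMul S]

/-- A left invariant mean on `X`, extended to a functional on `C_b(S)`. -/
theorem HasLeftInvariantMean.exists_extension {X : InvariantSubspace S}
    (hX : HasLeftInvariantMean X) : ∃ m : (S →ᵇ ℂ) →L[ℂ] ℂ, ‖m‖ ≤ 1 ∧ m 1 = 1 ∧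
      ∀ (s : S), ∀ f ∈ X.toSubmodule, m (leftTranslate s f) = m f := by
  obtain ⟨m₀, hm₀, hm₁, hinv⟩ := hX
  obtain ⟨m, hext, hnorm⟩ := exists_extension_norm_eq X.toSubmodule m₀
  refine ⟨m, (hnorm.trans hm₀).le, ?_, fun s f hf => ?_⟩
  · rw [← hm₁, ← hext]
  · have h := hinv s f hf
    rwa [← hext, ← hext] at h

theorem iterate_leftTranslate_apply (t : S) (f : S →ᵇ ℂ) (k : ℕ) (s : S) :
    ((leftTranslate t)^[k] f) s = f ((fun u => t * u)^[k] s) := by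
  induction k generalizing f with
  | zero => rfl
  | succ k ih =>
    rw [Function.iterate_succ_apply, ih, leftTranslate_apply, Function.iterate_succ_apply']

theorem iterate_leftTranslate_mem (X : InvariantSubspace S) (t : S) {f : S →ᵇ ℂ}
    (hf : f ∈ X.toSubmodule) (k : ℕ) : (leftTranslate t)^[k] f ∈ X.toSubmodule := by
  induction k with
  | zero => exact hf
  | succ k ih =>
    rw [Function.iterate_succ_apply']
    exact X.leftTranslate_mem' t ih

theorem apply_iterate_leftTranslate {X : InvariantSubspace S} {m : (S →ᵇ ℂ) →L[ℂ] ℂ}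
    (hinv : ∀ (s : S), ∀ f ∈ X.toSubmodule, m (leftTranslate s f) = m f) (t : S) {f : S →ᵇ ℂ}
    (hf : f ∈ X.toSubmodule) (k : ℕ) : m ((leftTranslate t)^[k] f) = m f := by
  induction k with
  | zero => rfl
  | succ k ih =>
    rw [Function.iterate_succ_apply', hinv _ _ (iterate_leftTranslate_mem X t hf k), ih]

end Mean

/-! ### Attractive points from means, and fixed points from attractive points. -/

section Attractive

variable {S : Type*} {H : Type*} [NormedAddCommGroup H] {C : Set H}

/-- The inequality for `a` survives composition, so no hybrid inequality is needed for products of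
generators. -/
theorem attractivePoints_of_closure [Semigroup S] {T : S → C → C} (hT : IsRepresentation T)
    {Λ : Set S} (hΛ : Subsemigroup.closure Λ = ⊤) {a : H}
    (h : ∀ s ∈ Λ, ∀ x : C, ‖a - T s x‖ ≤ ‖a - x‖) : a ∈ attractivePoints T := by
  intro s
  have hs : s ∈ Subsemigroup.closure Λ := hΛ ▸ Subsemigroup.mem_top s
  induction hs using Subsemigroup.closure_induction with
  | mem s hs => exact h s hs
  | mul s t _ _ hs ht =>
    intro x
    rw [hT]
    exact (hs _).trans (ht x)

variable [InnerProductSpace ℂ H]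

/-- The generalized hybrid inequality along an orbit `u`, summed up: the quadratic terms
telescope. -/
theorem sum_hybrid_le {α β : ℝ} {w z : H} {u : ℕ → H}
    (h : ∀ k, α * ‖w - u (k + 1)‖ ^ 2 + (1 - α) * ‖w - u k‖ ^ 2
      ≤ β * ‖z - u (k + 1)‖ ^ 2 + (1 - β) * ‖z - u k‖ ^ 2) (n : ℕ) :
    n * (‖w‖ ^ 2 - ‖z‖ ^ 2) - 2 * (∑ k ∈ Finset.range n,
      ((α : ℂ) * inner ℂ w (u (k + 1)) + (1 - α : ℂ) * inner ℂ w (u k)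
        - (β : ℂ) * inner ℂ z (u (k + 1)) - (1 - β : ℂ) * inner ℂ z (u k))).re
      ≤ (β - α) * (‖u n‖ ^ 2 - ‖u 0‖ ^ 2) := by
  induction n with
  | zero => simp
  | succ n ih =>
    have hn := h n
    simp only [@norm_sub_sq ℂ, RCLike.re_to_complex] at hn
    rw [Finset.sum_range_succ]
    simp only [Complex.add_re, Complex.sub_re, Complex.mul_re,
      Complex.sub_im, Complex.one_re, Complex.one_im, Complex.ofReal_re, Complex.ofReal_im,
      sub_self, zero_mul, sub_zero] at ih ⊢
    push_cast
    linarith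

variable [CompleteSpace H]

/-- The point of a closed convex set nearest to an attractive point is a common fixed point. -/
theorem commonFixedPoints_nonempty_of_attractivePoints {T : S → C → C} (hCc : IsClosed C)
    (hCv : Convex ℝ C) (hC : C.Nonempty) (h : (attractivePoints T).Nonempty) :
    (commonFixedPoints T).Nonempty := by
  let _ : InnerProductSpace ℝ H := InnerProductSpace.rclikeToReal ℂ H
  obtain ⟨a, ha⟩ := h
  obtain ⟨p, hp, hmin⟩ := exists_norm_eq_iInf_of_complete_convex hC hCc.isComplete hCv a
  -- The obtuse angle at `p` gives `‖q - p‖² ≤ ‖a - q‖² - ‖a - p‖²` for `q = T s p`, and attraction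
  -- makes the right side at most `0`.
  have hvar := (norm_eq_iInf_iff_real_inner_le_zero hCv hp).1 hmin
  refine ⟨⟨p, hp⟩, fun s => Subtype.ext ?_⟩
  have h1 := hvar _ (T s ⟨p, hp⟩).2
  have h2 := pow_le_pow_left₀ (norm_nonneg _) (ha s ⟨p, hp⟩) 2
  set q : H := (T s ⟨p, hp⟩ : H)
  have h3 : ‖a - q‖ ^ 2 = ‖a - p‖ ^ 2 - 2 * inner ℝ (a - p) (q - p) + ‖q - p‖ ^ 2 := by
    rw [← norm_sub_sq_real]
    congr 2
    abel
  have h4 : ‖q - p‖ ^ 2 ≤ 0 := by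
    simp only at h2
    linarith
  exact sub_eq_zero.1 (norm_eq_zero.1 (pow_eq_zero_iff two_ne_zero |>.1
    (le_antisymm h4 (sq_nonneg _))))

theorem exists_inner_eq_of_antilinear {g : H → ℂ} (hadd : ∀ y z, g (y + z) = g y + g z)
    (hsmul : ∀ (r : ℂ) y, g (r • y) = starRingEnd ℂ r * g y) {R : ℝ}
    (hR : ∀ y, ‖g y‖ ≤ R * ‖y‖) : ∃ a : H, ∀ y, g y = inner ℂ y a := by
  let l : H →ₗ[ℂ] ℂ :=
    { toFun := fun y => starRingEnd ℂ (g y)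
      map_add' := fun y z => by rw [hadd, map_add]
      map_smul' := fun r y => by simp [hsmul] }
  let L : H →L[ℂ] ℂ := l.mkContinuous R fun y => by simpa [l] using hR y
  refine ⟨(InnerProductSpace.toDual ℂ H).symm L, fun y => ?_⟩
  rw [← inner_conj_symm, InnerProductSpace.toDual_symm_apply]
  simp [L, l]

variable [Semigroup S] [TopologicalSpace S] [SeparatelyContinuousMul S]

/-- If all weak coordinates of a bounded orbit belong to a space with a left invariant mean, the
barycentre of the orbit with respect to the mean is an attractive point. -/
theorem attractivePoints_nonempty_of_mean {X : InvariantSubspace S} (hX : HasLeftInvariantMean X)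
    {T : S → C → C} (hT : IsRepresentation T) {Λ : Set S} (hΛ : Subsemigroup.closure Λ = ⊤)
    (hyb : ∀ s ∈ Λ, IsGeneralizedHybrid (T s)) {c : C} (hc : HasBoundedOrbit T c)
    (hmem : ∀ y : H, ∃ f ∈ X.toSubmodule, ∀ s, f s = inner ℂ y (T s c : H)) :
    (attractivePoints T).Nonempty := by
  obtain ⟨m, hm, hm1, hinv⟩ := hX.exists_extension
  choose f hfX hf using hmem
  obtain ⟨R, hR0, hR⟩ := hc.exists_pos_norm_le
  have hR : ∀ s, ‖(T s c : H)‖ ≤ R := fun s => hR _ ⟨s, rfl⟩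
  obtain ⟨a, ha⟩ := exists_inner_eq_of_antilinear (g := fun y => m (f y)) (R := R)
    (fun y z => by
      rw [← map_add]
      congr 1
      ext s
      simp [hf])
    (fun r y => by
      rw [← smul_eq_mul, ← map_smul]
      congr 1
      ext s
      simp [hf, mul_comm])
    (fun y => by
      refine (m.le_of_opNorm_le hm _).trans ?_
      rw [one_mul]
      refine (BoundedContinuousFunction.norm_le (by positivity)).2 fun s => ?_
      rw [hf, mul_comm]
      refine (norm_inner_le_norm _ _).trans ?_
      gcongr
      exact hR s)
  refine ⟨a, attractivePoints_of_closure hT hΛ fun t ht z => ?_⟩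
  obtain ⟨α, β, hαβ⟩ := hyb t ht
  set w : H := (T t z : H) with hw
  -- The linear part of the hybrid inequality. Invariance merges the weights `α, 1 - α` and `β, 1 -
  -- β`, leaving `⟪w, a⟫ - ⟪z, a⟫` as its mean.
  set q : S →ᵇ ℂ := (α : ℂ) • leftTranslate t (f w) + (1 - α : ℂ) • f w
    - (β : ℂ) • leftTranslate t (f z) - (1 - β : ℂ) • f z with hq
  have hqX : q ∈ X.toSubmodule :=
    sub_mem (sub_mem (add_mem (Submodule.smul_mem _ _ (X.leftTranslate_mem' t (hfX w)))
      (Submodule.smul_mem _ _ (hfX w))) (Submodule.smul_mem _ _ (X.leftTranslate_mem' t (hfX z))))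
      (Submodule.smul_mem _ _ (hfX z))
  have hmq : m q = inner ℂ w a - inner ℂ (z : H) a := by
    rw [hq, map_sub, map_sub, map_add, map_smul, map_smul, map_smul, map_smul, hinv _ _ (hfX w),
      hinv _ _ (hfX z), ha, ha]
    simp only [smul_eq_mul]
    ring
  -- The right side does not depend on `n`, so the factor of `n` cannot be positive.
  have hbound : ∀ n : ℕ, n * (‖w‖ ^ 2 - ‖(z : H)‖ ^ 2 - 2 * (m q).re) ≤ |β - α| * R ^ 2 := by
    intro n
    set Q : S →ᵇ ℂ := (-2 : ℂ) • ∑ k ∈ Finset.range n, (leftTranslate t)^[k] q with hQ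
    have hmQ : m Q = -2 * (n * m q) := by
      rw [hQ, map_smul, map_sum, Finset.sum_congr rfl
        (fun k _ => apply_iterate_leftTranslate hinv t hqX k)]
      simp
    have hle : ∀ s, (Q s).re ≤ |β - α| * R ^ 2 - n * (‖w‖ ^ 2 - ‖(z : H)‖ ^ 2) := by
      intro s
      -- The orbit starts at `T s c` rather than `c`: `S` need not have an identity to serve as `t ^
      -- 0`.
      set u : ℕ → C := fun k => T ((fun v => t * v)^[k] s) c with hu
      have hus : ∀ k, u (k + 1) = T t (u k) := fun k => by
        simp only [hu]
        rw [Function.iterate_succ_apply', hT]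
      have h1 := sum_hybrid_le (α := α) (β := β) (w := w) (z := (z : H))
        (u := fun k => (u k : H)) (fun k => by
          have := hαβ (u k) z
          rw [← hus] at this
          simpa only [norm_sub_rev w, norm_sub_rev (z : H)] using this) n
      have h2 : Q s = -2 * ∑ k ∈ Finset.range n,
          ((α : ℂ) * inner ℂ w (u (k + 1) : H) + (1 - α : ℂ) * inner ℂ w (u k : H)
          - (β : ℂ) * inner ℂ (z : H) (u (k + 1) : H)
          - (1 - β : ℂ) * inner ℂ (z : H) (u k : H)) := by
        rw [hQ, BoundedContinuousFunction.smul_apply, BoundedContinuousFunction.sum_apply,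
          smul_eq_mul]
        refine congrArg _ (Finset.sum_congr rfl fun k _ => ?_)
        rw [iterate_leftTranslate_apply]
        simp [hq, hf, hu, Function.iterate_succ_apply', -Function.iterate_succ]
      have h3 : (β - α) * (‖(u n : H)‖ ^ 2 - ‖(u 0 : H)‖ ^ 2) ≤ |β - α| * R ^ 2 := by
        refine (le_abs_self _).trans ?_
        rw [abs_mul]
        gcongr
        have hun := pow_le_pow_left₀ (norm_nonneg _) (hR ((fun v => t * v)^[n] s)) 2
        have hu0 := pow_le_pow_left₀ (norm_nonneg _) (hR s) 2
        have e0 : ‖(u 0 : H)‖ = ‖(T s c : H)‖ := rfl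
        have en : ‖(u n : H)‖ = ‖(T ((fun v => t * v)^[n] s) c : H)‖ := rfl
        rw [e0, en, abs_le]
        constructor <;> nlinarith [sq_nonneg ‖(T s c : H)‖,
          sq_nonneg ‖(T ((fun v => t * v)^[n] s) c : H)‖]
      have h4 : (Q s).re = -2 * (∑ k ∈ Finset.range n,
          ((α : ℂ) * inner ℂ w (u (k + 1) : H) + (1 - α : ℂ) * inner ℂ w (u k : H)
          - (β : ℂ) * inner ℂ (z : H) (u (k + 1) : H)
          - (1 - β : ℂ) * inner ℂ (z : H) (u k : H))).re := by
        rw [h2, show (-2 : ℂ) = ((-2 : ℝ) : ℂ) by norm_num, Complex.re_ofReal_mul]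
      linarith
    have h5 := re_apply_le_of_forall_re_le hm hm1 hle
    have h6 : (m Q).re = -2 * (n * (m q).re) := by
      rw [hmQ, show (-2 : ℂ) * (n * m q) = (((-2 : ℝ) * n : ℝ) : ℂ) * m q by push_cast; ring,
        Complex.re_ofReal_mul]
      ring
    linarith
  have hle0 : ‖w‖ ^ 2 - ‖(z : H)‖ ^ 2 - 2 * (m q).re ≤ 0 := by
    by_contra! hpos
    obtain ⟨n, hn⟩ := exists_lt_nsmul hpos (|β - α| * R ^ 2)
    rw [nsmul_eq_mul] at hn
    exact absurd (hbound n) (not_le.2 hn)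
  rw [hmq] at hle0
  refine le_of_sq_le_sq ?_ (norm_nonneg _)
  rw [norm_sub_rev a, norm_sub_rev a, @norm_sub_sq ℂ, @norm_sub_sq ℂ]
  simp only [RCLike.re_to_complex]
  simp only [Complex.sub_re] at hle0
  linarith

end Attractive

/-! ### The weak topology of a Hilbert space. -/

section WeakTopology

variable {H : Type*} [NormedAddCommGroup H] [InnerProductSpace ℂ H] {C : Set H}

/-- The inclusion of `C` into `H`. -/
def Wk.val : Wk C → H := (Subtype.val : C → H)

/-- The inclusion of `C`, with its weak topology, into `H` with its weak topology. -/
def Wk.toWeak (x : Wk C) : WeakSpace ℂ H := toWeakSpace ℂ H x.val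

theorem Wk.isEmbedding_toWeak : IsEmbedding (Wk.toWeak : Wk C → WeakSpace ℂ H) :=
  ⟨⟨rfl⟩, (toWeakSpace ℂ H).injective.comp Subtype.val_injective⟩

instance : T2Space (WeakSpace ℂ H) :=
  (NormedSpace.isEmbedding_inclusionInDoubleDualWeak ℂ H).t2Space

instance : T2Space (Wk C) :=
  Wk.isEmbedding_toWeak.t2Space

/-- The weakly continuous function `x ↦ ⟪y, x⟫` on `C`. -/
def wkInner (C : Set H) (y : H) : C(Wk C, ℂ) where
  toFun x := inner ℂ y x.val
  continuous_toFun :=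
    (WeakBilin.eval_continuous (topDualPairing ℂ H).flip (innerSL ℂ y)).comp
      Wk.isEmbedding_toWeak.continuous

theorem isWeaklyClosed_of_convex (hC : IsClosed C) (hCv : Convex ℝ C) : IsWeaklyClosed C := by
  rw [IsWeaklyClosed, ← hC.closure_eq, hCv.toWeakSpace_closure (𝕜 := ℂ)]
  exact isClosed_closure

variable [CompleteSpace H]

/-- Reflexivity by two uses of Riesz representation: functionals on `H` are `⟪y, ·⟫`, and `y ↦ ξ ⟪y,
·⟫` is bounded and antilinear. -/
theorem inclusionInDoubleDualWeak_surjective :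
    Function.Surjective (NormedSpace.inclusionInDoubleDualWeak ℂ H) := by
  intro ξ
  let η : StrongDual ℂ (StrongDual ℂ H) := WeakDual.toStrongDual ξ
  have hη : ∀ f, η f = ξ f := fun f => rfl
  obtain ⟨a, ha⟩ := exists_inner_eq_of_antilinear (H := H) (g := fun y => η (innerSL ℂ y))
    (R := ‖η‖) (fun y z => by rw [map_add, map_add])
    (fun r y => by rw [map_smulₛₗ, map_smul, smul_eq_mul])
    (fun y => by simpa using η.le_opNorm (innerSL ℂ y))
  refine ⟨toWeakSpace ℂ H a, DFunLike.ext _ _ fun f => ?_⟩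
  obtain ⟨y, rfl⟩ := (InnerProductSpace.toDual ℂ H).surjective f
  exact (ha y).symm

/-- Banach–Alaoglu in the bidual, carried back to `H` by reflexivity. -/
theorem isCompact_weak_closedBall (R : ℝ) :
    IsCompact (toWeakSpace ℂ H '' Metric.closedBall 0 R) := by
  have h := (NormedSpace.isEmbedding_inclusionInDoubleDualWeak ℂ H).isCompact_preimage'
    (WeakDual.isCompact_closedBall (𝕜 := ℂ) (E := StrongDual ℂ H) 0 R)
    (fun ξ _ => inclusionInDoubleDualWeak_surjective ξ)
  convert h using 1
  ext x
  obtain ⟨x, rfl⟩ := (toWeakSpace ℂ H).surjective x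
  rw [(toWeakSpace ℂ H).injective.mem_set_image, mem_preimage, mem_preimage,
    mem_closedBall_zero_iff, mem_closedBall_zero_iff,
    ← (NormedSpace.inclusionInDoubleDualLi (𝕜 := ℂ) (E := H)).norm_map x]
  rfl

end WeakTopology

/-! ### Functions on `S` induced from a compact space. -/

section Pullback

variable {S : Type*} [TopologicalSpace S] {K : Type*} [TopologicalSpace K] [CompactSpace K]

/-- Composition with a continuous map `S → K`, as an operator from `C(K)` to `C_b(S)`. -/
def pullback (o : C(S, K)) : C(K, ℂ) →L[ℂ] (S →ᵇ ℂ) :=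
  LinearMap.mkContinuous
    { toFun := fun g => (BoundedContinuousFunction.mkOfCompact g).compContinuous o
      map_add' := fun _ _ => rfl
      map_smul' := fun _ _ => rfl } 1 fun g => by
    rw [one_mul]
    exact (BoundedContinuousFunction.norm_le (norm_nonneg _)).2 fun s => g.norm_coe_le_norm _

@[simp] theorem pullback_apply (o : C(S, K)) (g : C(K, ℂ)) (s : S) :
    pullback o g s = g (o s) := rfl

end Pullback

/-! ### Weak coordinates of the orbit lie in `LUC(S)`, `AP(S)` or `WAP(S)`. -/

section Membership

variable {S : Type*} {H : Type*} [NormedAddCommGroup H] [InnerProductSpace ℂ H] {C : Set H}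

/-- A common bound for `⟪y, x⟫`, `x` in the weak orbit closure. -/
theorem exists_norm_wkInner_le (T : S → C → C) (c : C) [CompactSpace (weakOrbitClosure T c)]
    (y : H) : ∃ M, 0 ≤ M ∧ ∀ x ∈ weakOrbitClosure T c, ‖wkInner C y x‖ ≤ M := by
  obtain ⟨M, hM⟩ := (isCompact_iff_compactSpace.2
    (inferInstance : CompactSpace (weakOrbitClosure T c))).exists_bound_of_continuousOn
    (wkInner C y).continuous.continuousOn
  exact ⟨max M 0, le_max_right _ _, fun x hx => (hM x hx).trans (le_max_left _ _)⟩

variable {T : S → C → C} {c : C}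

theorem compactSpace_weakOrbitClosure [CompleteSpace H] (hC : IsWeaklyClosed C)
    (hc : HasBoundedOrbit T c) : CompactSpace (weakOrbitClosure T c) := by
  rw [← isCompact_iff_compactSpace]
  obtain ⟨R, hR⟩ := hc.subset_closedBall 0
  have hrange : range (Wk.toWeak : Wk C → WeakSpace ℂ H) = toWeakSpace ℂ H '' C := by
    ext x
    constructor
    · rintro ⟨y, rfl⟩
      exact ⟨_, y.2, rfl⟩
    · rintro ⟨y, hy, rfl⟩
      exact ⟨⟨y, hy⟩, rfl⟩
  have hemb : IsClosedEmbedding (Wk.toWeak : Wk C → WeakSpace ℂ H) :=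
    ⟨Wk.isEmbedding_toWeak, by rw [hrange]; exact hC⟩
  refine (hemb.isCompact_preimage (isCompact_weak_closedBall R)).closure_of_subset ?_
  rintro _ ⟨s, rfl⟩
  exact ⟨_, hR ⟨s, rfl⟩, rfl⟩

/-- As all orbits are bounded, the closure of `{T_s}` in the product is compact by Tychonoff. Its
restriction to `K` is therefore closed, so every limit on `K` extends to a limit on `C`, which is
continuous. -/
theorem isWeaklyQuasiEquicontinuousOn_of_isWeaklyQuasiEquicontinuous [CompleteSpace H]
    (hC : IsWeaklyClosed C) (h : IsWeaklyQuasiEquicontinuous T) (hb : ∀ x, HasBoundedOrbit T x)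
    (K : Set (Wk C)) : IsWeaklyQuasiEquicontinuousOn T K := by
  have hcomp : IsCompact (closure (range (wkMap T))) := by
    refine (isCompact_univ_pi fun x : Wk C => isCompact_iff_compactSpace.2
      (compactSpace_weakOrbitClosure hC (hb x))).closure_of_subset ?_
    rintro _ ⟨s, rfl⟩ x -
    exact subset_closure ⟨s, rfl⟩
  have hres : Continuous fun (g : Wk C → Wk C) (x : K) => g x := by fun_prop
  have hsub : closure (range fun (s : S) (x : K) => wkMap T s x.1) ⊆
      (fun (g : Wk C → Wk C) (x : K) => g x) '' closure (range (wkMap T)) := by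
    refine closure_minimal ?_ (hcomp.image hres).isClosed
    rintro _ ⟨s, rfl⟩
    exact ⟨wkMap T s, subset_closure ⟨s, rfl⟩, rfl⟩
  intro g hg
  obtain ⟨g', hg', rfl⟩ := hsub hg
  exact (h g' hg').comp continuous_subtype_val

theorem wkMap_mem_weakOrbitClosure [Semigroup S] (hT : IsRepresentation T) {s : S}
    (hs : Continuous (wkMap T s)) {x : Wk C} (hx : x ∈ weakOrbitClosure T c) : wkMap T s x ∈ weakOrbitClosure T c := by
  refine map_mem_closure hs hx ?_
  rintro _ ⟨t, rfl⟩
  exact ⟨s * t, hT s t c⟩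

variable [TopologicalSpace S]

/-- The orbit map, with values in the weak closure of the orbit. -/
def orbitMap (T : S → C → C) (c : C) (h : IsWeaklyContinuousOrbit T c) :
    C(S, weakOrbitClosure T c) :=
  ⟨fun s => ⟨wkMap T s c, subset_closure ⟨s, rfl⟩⟩, h.subtype_mk _⟩

/-- The function `x ↦ ⟪y, σ x⟫` on the weak orbit closure. -/
def coordinate (T : S → C → C) (c : C) (y : H) (σ : weakOrbitClosure T c → Wk C)
    (hσ : Continuous σ) : C(weakOrbitClosure T c, ℂ) :=
  (wkInner C y).comp ⟨σ, hσ⟩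

variable [Semigroup S] [SeparatelyContinuousMul S] [CompactSpace (weakOrbitClosure T c)]

/-- All translates are images under one bounded operator from `C(K)`, so their continuity or
compactness can be checked in `C(K)`. -/
theorem leftTranslate_pullback (hT : IsRepresentation T) (h : IsWeaklyContinuousOrbit T c) (y : H)
    {s : S} (hs : Continuous (wkMap T s)) :
    leftTranslate s (pullback (orbitMap T c h)
        (coordinate T c y Subtype.val continuous_subtype_val)) =
      pullback (orbitMap T c h)
        (coordinate T c y (fun x => wkMap T s x) (hs.comp continuous_subtype_val)) := by
  ext t
  exact congrArg (fun x : C => inner ℂ y (x : H)) (hT s t c)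

/-- Currying a jointly continuous function on `S × K` gives a norm continuous map into `C(K)`,
because `K` is compact. -/
theorem pullback_mem_LUC (hT : IsRepresentation T) (hj : IsWeaklyJointlyContinuous T)
    (h : IsWeaklyContinuousOrbit T c) (y : H) :
    pullback (orbitMap T c h) (coordinate T c y Subtype.val continuous_subtype_val) ∈
      (LUC S).toSubmodule := by
  have hs : ∀ s, Continuous (wkMap T s) := fun s =>
    Continuous.comp (g := fun p : S × Wk C => wkMap T p.1 p.2) hj (Continuous.prodMk_right s)
  change Continuous fun s => leftTranslate s _
  simp only [leftTranslate_pullback hT h y (hs _)]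
  refine (pullback _).continuous.comp ?_
  have hj' : Continuous fun p : S × weakOrbitClosure T c => wkInner C y (wkMap T p.1 p.2) :=
    (wkInner C y).continuous.comp (Continuous.comp (g := fun p : S × Wk C => wkMap T p.1 p.2) hj
      (continuous_fst.prodMk (continuous_subtype_val.comp continuous_snd)))
  exact (ContinuousMap.curry ⟨_, hj'⟩).continuous

theorem pullback_mem_AP (hT : IsRepresentation T) (hsep : IsWeaklySeparatelyContinuous T)
    (he : IsWeaklyEquicontinuous T) (y : H) :
    pullback (orbitMap T c (hsep.1 c)) (coordinate T c y Subtype.val continuous_subtype_val) ∈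
      (AP S).toSubmodule := by
  obtain ⟨M, -, hM⟩ := exists_norm_wkInner_le T c y
  let G : S → (weakOrbitClosure T c →ᵇ ℂ) := fun s => BoundedContinuousFunction.mkOfCompact
    (coordinate T c y (fun x => wkMap T s x) ((hsep.2 s).comp continuous_subtype_val))
  have hG : IsCompact (closure (range G)) := by
    refine BoundedContinuousFunction.arzela_ascoli (Metric.closedBall 0 M)
      (isCompact_closedBall _ _) _ ?_ ?_
    · rintro _ x ⟨s, rfl⟩
      rw [mem_closedBall_zero_iff]
      exact hM _ (wkMap_mem_weakOrbitClosure hT (hsep.2 s) x.2)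
    · intro x U hU
      have := continuous_subtype_val.continuousAt.eventually (he (innerSL ℂ y) x.1 U hU)
      filter_upwards [this] with x' hx'
      rintro ⟨_, s, rfl⟩
      exact hx' s
  refine ⟨_, hG.image (BoundedContinuousFunction.continuous_compContinuous
    (orbitMap T c (hsep.1 c))), fun s => ?_⟩
  rw [leftTranslate_pullback hT (hsep.1 c) y (hsep.2 s)]
  exact ⟨G s, subset_closure ⟨s, rfl⟩, rfl⟩

/-- The pointwise closure `E` of the action on `K` is compact and, by quasi-equicontinuity, consists
of continuous maps. By Grothendieck's theorem the coordinates of its members form a weakly compact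
family. -/
theorem pullback_mem_WAP (hT : IsRepresentation T) (hsep : IsWeaklySeparatelyContinuous T)
    (hq : IsWeaklyQuasiEquicontinuousOn T (weakOrbitClosure T c)) (y : H) :
    pullback (orbitMap T c (hsep.1 c)) (coordinate T c y Subtype.val continuous_subtype_val) ∈
      (WAP S).toSubmodule := by
  obtain ⟨M, hM0, hM⟩ := exists_norm_wkInner_le T c y
  set E : Set (weakOrbitClosure T c → Wk C) :=
    closure (range fun (s : S) (x : weakOrbitClosure T c) => wkMap T s x.1) with hE
  have hEsub : E ⊆ univ.pi fun _ => weakOrbitClosure T c := by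
    refine closure_minimal ?_ (isClosed_set_pi fun _ _ => isClosed_closure)
    rintro _ ⟨s, rfl⟩ x -
    exact wkMap_mem_weakOrbitClosure hT (hsep.2 s) x.2
  have hEc : IsCompact E :=
    (isCompact_univ_pi fun _ => isCompact_iff_compactSpace.2 inferInstance).of_isClosed_subset
      isClosed_closure hEsub
  have : CompactSpace E := isCompact_iff_compactSpace.1 hEc
  let G : E → C(weakOrbitClosure T c, ℂ) := fun σ => coordinate T c y σ (hq _ σ.2)
  have hGp : ∀ x, Continuous fun σ => G σ x := fun x =>
    (wkInner C y).continuous.comp ((continuous_apply x).comp continuous_subtype_val)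
  have hGM : ∀ σ, ‖G σ‖ ≤ M := fun σ =>
    (ContinuousMap.norm_le _ hM0).2 fun x => hM _ (hEsub σ.2 x trivial)
  have hGw : Continuous fun σ =>
      toWeakSpace ℂ (S →ᵇ ℂ) (pullback (orbitMap T c (hsep.1 c)) (G σ)) :=
    -- A functional `φ` on `C_b(S)` becomes one on `C(K)` after composition with the pullback.
    WeakBilin.continuous_of_continuous_eval _ fun φ =>
      continuous_apply_of_pointwise G hGp hGM (φ.comp (pullback (orbitMap T c (hsep.1 c))))
  refine ⟨_, isCompact_range hGw, fun s => ?_⟩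
  rw [leftTranslate_pullback hT (hsep.1 c) y (hsep.2 s)]
  exact ⟨⟨_, subset_closure ⟨s, rfl⟩⟩, rfl⟩

end Membership

/-! ### The four conditions. -/

section Main

variable {S : Type*} [Semigroup S] [TopologicalSpace S] [SeparatelyContinuousMul S]
  {H : Type*} [NormedAddCommGroup H] [InnerProductSpace ℂ H] [CompleteSpace H] {C : Set H}
  {T : S → C → C} {Λ : Set S} {c : C}

theorem attractivePoints_nonempty_of_CbCondition (hT : IsRepresentation T)
    (hΛ : Subsemigroup.closure Λ = ⊤) (hyb : ∀ s ∈ Λ, IsGeneralizedHybrid (T s))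
    (hc : HasBoundedOrbit T c) (h : CbCondition T c) : (attractivePoints T).Nonempty := by
  refine attractivePoints_nonempty_of_mean h.1 hT hΛ hyb hc fun y => ?_
  obtain ⟨R, hR0, hR⟩ := hc.exists_pos_norm_le
  refine ⟨BoundedContinuousFunction.ofNormedAddCommGroup
    (fun s => inner ℂ y (T s c : H)) ((wkInner C y).continuous.comp h.2) (‖y‖ * R) fun s => ?_,
    trivial, fun s => rfl⟩
  refine (norm_inner_le_norm _ _).trans ?_
  gcongr
  exact hR _ ⟨s, rfl⟩

theorem attractivePoints_nonempty_of_isWeaklyClosed (hT : IsRepresentation T)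
    (hΛ : Subsemigroup.closure Λ = ⊤) (hyb : ∀ s ∈ Λ, IsGeneralizedHybrid (T s))
    (hc : HasBoundedOrbit T c) (hC : IsWeaklyClosed C)
    (h : LUCCondition T ∨ APCondition T ∨ WAPCondition T c) : (attractivePoints T).Nonempty := by
  have := compactSpace_weakOrbitClosure hC hc
  rcases h with ⟨hm, hj⟩ | ⟨hm, hsep, he⟩ | ⟨hm, hsep, hq⟩
  · have hcont : IsWeaklyContinuousOrbit T c :=
      Continuous.comp (g := fun p : S × Wk C => wkMap T p.1 p.2) hj
        (Continuous.prodMk_left (show Wk C from c))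
    exact attractivePoints_nonempty_of_mean hm hT hΛ hyb hc fun y =>
      ⟨_, pullback_mem_LUC hT hj hcont y, fun _ => rfl⟩
  · exact attractivePoints_nonempty_of_mean hm hT hΛ hyb hc fun y =>
      ⟨_, pullback_mem_AP hT hsep he y, fun _ => rfl⟩
  · have hq' : IsWeaklyQuasiEquicontinuousOn T (weakOrbitClosure T c) :=
      hq.elim id fun h =>
        isWeaklyQuasiEquicontinuousOn_of_isWeaklyQuasiEquicontinuous hC h.1 h.2 _
    exact attractivePoints_nonempty_of_mean hm hT hΛ hyb hc fun y =>
      ⟨_, pullback_mem_WAP hT hsep hq' y, fun _ => rfl⟩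

end Main

end SemigroupAction
end

theorem mainTheorem6 {S : Type*} [Semigroup S] [TopologicalSpace S] [T2Space S]
    [SeparatelyContinuousMul S]
    {H : Type*} [NormedAddCommGroup H] [InnerProductSpace ℂ H] [CompleteSpace H]
    (C : Set H) (T : S → C → C) (hT : SemigroupAction.IsRepresentation T)
    (Λ : Set S) (hΛ : Subsemigroup.closure Λ = ⊤)
    (hyb : ∀ s ∈ Λ, SemigroupAction.IsGeneralizedHybrid (T s))
    (c : C) (hc : SemigroupAction.HasBoundedOrbit T c) :
    (SemigroupAction.CbCondition T c → (SemigroupAction.attractivePoints T).Nonempty) ∧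
    (SemigroupAction.IsWeaklyClosed C →
      (SemigroupAction.LUCCondition T ∨ SemigroupAction.APCondition T ∨
        SemigroupAction.WAPCondition T c) →
      (SemigroupAction.attractivePoints T).Nonempty) ∧
    (IsClosed C → Convex ℝ C →
      (SemigroupAction.CbCondition T c ∨ SemigroupAction.LUCCondition T ∨
        SemigroupAction.APCondition T ∨ SemigroupAction.WAPCondition T c) →
      (SemigroupAction.commonFixedPoints T).Nonempty) := by
  have h1 := SemigroupAction.attractivePoints_nonempty_of_CbCondition hT hΛ hyb hc
  have h2 := SemigroupAction.attractivePoints_nonempty_of_isWeaklyClosed hT hΛ hyb hc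
  refine ⟨h1, h2, fun hCc hCv h => ?_⟩
  refine SemigroupAction.commonFixedPoints_nonempty_of_attractivePoints hCc hCv ⟨c, c.2⟩ ?_
  exact h.elim h1 (h2 (SemigroupAction.isWeaklyClosed_of_convex hCc hCv))
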